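/- Let the locations $\mathbf d_1,\mathbf d_2,\dots$ of the base stations (BSs) be the points of a homogeneous Poisson point process $\Phi_b=\{\mathbf d_i\}$ in $\mathbb R^2$ with density $\lambda_b>0$. Let $\alpha\ge 2$ be the path-loss exponent, $D>0$ the radius of the cooperation region around the origin, $M_{\mathrm t}\ge 2$ an integer (the number of transmit antennas per BS) and $p^c>0$ the communication power. Let $$U=\sum_{i:\ \|\mathbf d_i\|\le D} g_i\,\|\mathbf d_i\|^{-\alpha},\qquad I=\sum_{j:\ \|\mathbf d_j\|> D} g_j\,\|\mathbf d_j\|^{-\alpha}\ \in[0,\infty],$$ where, independently of the BS locations, the gains $g_i$ of the BSs with $\|\mathbf d_i\|\le D$ are independent with the Gamma distribution $\Gamma(M_{\mathrm t}-1,p^c)$ (shape $M_{\mathrm t}-1$, scale $p^c$), and the gains $g_j$ of the BSs with $\|\mathbf d_j\|>D$ are independent with distribution $\Gamma(1,1)=\mathrm{Exp}(1)$. For $a\in[0,1]$ put $B(a,b,c)=\int_0^a t^{b-1}(1-t)^{c-1}\,dt$ and $\bar B(a,b,c)=\int_a^1 t^{b-1}(1-t)^{c-1}\,dt$ (with values in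 $[0,\infty]$), and define $$\mathrm H_1(x,K,\alpha,D)=K x^{2/\alpha}\,\bar B\!\left(\tfrac{x}{x+D^\alpha},\,1-\tfrac2\alpha,\,K+\tfrac2\alpha\right)+D^2\left(1-(1+xD^{-\alpha})^{-K}\right),$$ $$\mathrm H_2(x,\alpha,D)=D^2\left((1+xD^{-\alpha})^{-1}-1\right)+x^{2/\alpha}\,B\!\left(\tfrac{x}{x+D^\alpha},\,1-\tfrac2\alpha,\,1+\tfrac2\alpha\right).$$ Then for every real $z\ge 0$, with the conventions $0\cdot\infty=0$ and $e^{-\infty}=0$, $$\mathrm E[e^{-zU}]=\exp\!\left[-\pi\lambda_b\,\mathrm H_1(zp^c,M_{\mathrm t}-1,\alpha,D)\right],\qquad \mathrm E[e^{-zI}]=\exp\!\left[-\pi\lambda_b\,\mathrm H_2(z,\alpha,D)\right].$$ For $\alpha>2$ both exponents are finite. For $\alpha=2$ the exponent of the first formula is finite, while $I=\infty$ almost surely and, for $z>0$, $\mathrm H_2(z,2,D)=\infty$, so that both sides of the second formula are $0$. -/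

import Mathlib

open MeasureTheory ProbabilityTheory Set
open scoped ENNReal NNReal

noncomputable section

/-- The number of points (counted with multiplicity) of the sequence `d 0 ω, d 1 ω, …` that lie
in the region `A`. -/
def pointCount {Ω : Type*} (d : ℕ → Ω → EuclideanSpace ℝ (Fin 2))
    (A : Set (EuclideanSpace ℝ (Fin 2))) (ω : Ω) : ℕ∞ :=
  {i : ℕ | d i ω ∈ A}.encard

/-- The random points `d 0, d 1, …` enumerate a homogeneous Poisson point process in the plane
with intensity `lam`: the number of points in a region of finite area is Poisson distributed with
mean `lam` times the area, and the numbers of points in pairwise disjoint regions are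
independent. -/
structure IsHomogeneousPPP {Ω : Type*} [MeasurableSpace Ω] (P : Measure Ω)
    (d : ℕ → Ω → EuclideanSpace ℝ (Fin 2)) (lam : ℝ) : Prop where
  measurable : ∀ i, Measurable (d i)
  poisson_count : ∀ A : Set (EuclideanSpace ℝ (Fin 2)), MeasurableSet A → volume A ≠ ∞ →
    ∀ k : ℕ, P {ω | pointCount d A ω = (k : ℕ∞)} =
      poissonMeasure (lam.toNNReal * (volume A).toNNReal) {k}
  indep_count : ∀ (n : ℕ) (A : Fin n → Set (EuclideanSpace ℝ (Fin 2))),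
    (∀ j, MeasurableSet (A j)) → (∀ j, volume (A j) ≠ ∞) →
    Pairwise (fun j k => Disjoint (A j) (A k)) →
    iIndepFun (fun j => pointCount d (A j)) P

/-- The power received at the origin from the stations at distance at most `D`:
the sum of `g i * ‖d i‖ ^ (-α)` over all `i` with `‖d i‖ ≤ D`, as a value in `[0, ∞]`. -/
def usefulSignal {Ω : Type*} (d : ℕ → Ω → EuclideanSpace ℝ (Fin 2)) (g : ℕ → Ω → ℝ)
    (α D : ℝ) (ω : Ω) : ℝ≥0∞ :=
  open Classical in
  ∑' i, if ‖d i ω‖ ≤ D then ENNReal.ofReal (g i ω) * ‖d i ω‖ₑ ^ (-α) else 0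

/-- The power received at the origin from the stations at distance more than `D`:
the sum of `g i * ‖d i‖ ^ (-α)` over all `i` with `D < ‖d i‖`, as a value in `[0, ∞]`. -/
def interference {Ω : Type*} (d : ℕ → Ω → EuclideanSpace ℝ (Fin 2)) (g : ℕ → Ω → ℝ)
    (α D : ℝ) (ω : Ω) : ℝ≥0∞ :=
  open Classical in
  ∑' i, if D < ‖d i ω‖ then ENNReal.ofReal (g i ω) * ‖d i ω‖ₑ ^ (-α) else 0

/-- `e ^ (-x)` for `x` in `[0, ∞]`, with `e ^ (-∞) = 0`. -/
def expNeg (x : ℝ≥0∞) : ℝ :=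
  open Classical in
  if x = ∞ then 0 else Real.exp (-x.toReal)

/-- The Laplace transform `z ↦ E[e ^ (-z X)]` of a random variable `X` with values in `[0, ∞]`,
for `z ≥ 0` (with `0 * ∞ = 0`). -/
def laplaceTransform {Ω : Type*} [MeasurableSpace Ω] (P : Measure Ω) (X : Ω → ℝ≥0∞)
    (z : ℝ) : ℝ :=
  ∫ ω, expNeg (ENNReal.ofReal z * X ω) ∂P

/-- The integrand `t ^ (b - 1) * (1 - t) ^ (c - 1)` of the incomplete Beta functions. -/
def betaIntegrand (b c t : ℝ) : ℝ := t ^ (b - 1) * (1 - t) ^ (c - 1)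

/-- The lower incomplete Beta function `B(a, b, c)`. -/
def lowerBeta (a b c : ℝ) : ℝ := ∫ t in (0 : ℝ)..a, betaIntegrand b c t

/-- The upper incomplete Beta function `B̄(a, b, c)`. -/
def upperBeta (a b c : ℝ) : ℝ := ∫ t in a..(1 : ℝ), betaIntegrand b c t

/-- The function `H₁(x, K, α, D)` of the useful signal. -/
def H₁ (x K α D : ℝ) : ℝ :=
  K * x ^ (2 / α) * upperBeta (x / (x + D ^ α)) (1 - 2 / α) (K + 2 / α)
    + D ^ 2 * (1 - (1 + x * D ^ (-α)) ^ (-K))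

/-- The function `H₂(x, α, D)` of the interference. -/
def H₂ (x α D : ℝ) : ℝ :=
  D ^ 2 * ((1 + x * D ^ (-α))⁻¹ - 1)
    + x ^ (2 / α) * lowerBeta (x / (x + D ^ α)) (1 - 2 / α) (1 + 2 / α)

end

/-! Both signals are shot noise over a marked Poisson process, so everything rests on the Laplace
functional `E exp(-∑ F(d i, g i)) = exp(-λ ∫ (1 - E exp(-F(x, g))) dx)`
(`lintegral_eneg_tsum_mark`). Without marks it follows from the Poisson generating function for
simple functions of bounded support, then by monotone limits. Independent marks are averaged out and
absorbed into the function of the position.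

For Gamma gains of shape `K` and rate `ρ` the inner expectation is `(1 + s / ρ) ^ (-K)`, and polar
coordinates leave `π λ` times the integral of `2 r (1 - (1 + x r ^ (-α)) ^ (-K))` over the
admissible radii, where `x = z / ρ`. As functions of the radius, `H₁` is an antiderivative vanishing
at `0`, and for `K = 1`, `α > 2`, `-H₂` is an antiderivative vanishing at infinity.

For `α = 2` the radial integrand decays only like `1 / r`. The exponent is infinite, so `E exp(-I) =
0`, which forces `I = ∞` almost surely. Working in `[0, ∞]` with `exp(-∞) = 0` treats convergent and
divergent sums alike. -/

/-! ### The exponential on `[0, ∞]` and its expectations -/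

/-- `e ^ (-x)` as a function from `[0, ∞]` to `[0, ∞]`. -/
noncomputable def eneg (x : ℝ≥0∞) : ℝ≥0∞ := ENNReal.ofReal (expNeg x)

@[simp] lemma eneg_top : eneg ∞ = 0 := by simp [eneg, expNeg]

lemma eneg_of_ne_top {x : ℝ≥0∞} (hx : x ≠ ∞) : eneg x = ENNReal.ofReal (Real.exp (-x.toReal)) := by
  simp [eneg, expNeg, hx]

lemma eneg_ofReal {t : ℝ} (ht : 0 ≤ t) :
    eneg (ENNReal.ofReal t) = ENNReal.ofReal (Real.exp (-t)) := by
  rw [eneg_of_ne_top ENNReal.ofReal_ne_top, ENNReal.toReal_ofReal ht]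

@[simp] lemma eneg_zero : eneg 0 = 1 := by simp [eneg_of_ne_top]

lemma eneg_add (x y : ℝ≥0∞) : eneg (x + y) = eneg x * eneg y := by
  by_cases hx : x = ∞
  · simp [hx]
  by_cases hy : y = ∞
  · simp [hy]
  rw [eneg_of_ne_top hx, eneg_of_ne_top hy, eneg_of_ne_top (by simp [hx, hy]),
    ← ENNReal.ofReal_mul (Real.exp_nonneg _), ← Real.exp_add, ENNReal.toReal_add hx hy, neg_add]

lemma eneg_sum {ι : Type*} (s : Finset ι) (f : ι → ℝ≥0∞) :
    eneg (∑ i ∈ s, f i) = ∏ i ∈ s, eneg (f i) := by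
  classical
  induction s using Finset.induction_on with
  | empty => simp
  | insert a s ha ih => rw [Finset.sum_insert ha, Finset.prod_insert ha, eneg_add, ih]

lemma eneg_nat_mul (k : ℕ) (c : ℝ≥0∞) : eneg (k * c) = eneg c ^ k := by
  simpa using eneg_sum (Finset.range k) fun _ => c

lemma eneg_antitone : Antitone eneg := by
  intro x y hxy
  by_cases hy : y = ∞
  · simp [hy]
  have hx : x ≠ ∞ := ne_top_of_le_ne_top hy hxy
  rw [eneg_of_ne_top hx, eneg_of_ne_top hy]
  apply ENNReal.ofReal_le_ofReal
  have := ENNReal.toReal_mono hy hxy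
  gcongr

lemma eneg_le_one (x : ℝ≥0∞) : eneg x ≤ 1 := by
  simpa using eneg_antitone (zero_le (a := x))

lemma eneg_ne_top (x : ℝ≥0∞) : eneg x ≠ ∞ := ENNReal.ofReal_ne_top

lemma eneg_eq_zero_iff {x : ℝ≥0∞} : eneg x = 0 ↔ x = ∞ := by
  refine ⟨fun h => ?_, fun h => by simp [h]⟩
  by_contra hx
  rw [eneg_of_ne_top hx, ENNReal.ofReal_eq_zero] at h
  exact absurd h (not_le.2 (Real.exp_pos _))

lemma eneg_continuous : Continuous eneg := by
  rw [continuous_iff_continuousAt]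
  intro x
  by_cases hx : x = ∞
  · subst hx
    rw [ContinuousAt, eneg_top]
    refine tendsto_order.2 ⟨fun a ha => absurd ha (by simp), fun a ha => ?_⟩
    obtain ⟨b, hb0, hba⟩ := ENNReal.lt_iff_exists_nnreal_btwn.1 ha
    have hb : 0 < (b : ℝ) := by exact_mod_cast hb0
    -- Beyond `-log b` the exponential is at most `b`; the maximum with `0` keeps the threshold
    -- nonnegative when `b > 1`.
    filter_upwards [lt_mem_nhds (ENNReal.ofReal_lt_top (r := max 0 (-Real.log b)))] with y hy
    refine lt_of_le_of_lt (eneg_antitone hy.le) ?_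
    rw [eneg_ofReal (le_max_left _ _)]
    refine lt_of_le_of_lt ?_ hba
    rw [← ENNReal.ofReal_coe_nnreal]
    apply ENNReal.ofReal_le_ofReal
    calc Real.exp (-max 0 (-Real.log b)) ≤ Real.exp (Real.log b) := by
          gcongr
          linarith [le_max_right 0 (-Real.log (b : ℝ))]
      _ = b := Real.exp_log hb
  · have h1 : ContinuousAt (fun y : ℝ≥0∞ => ENNReal.ofReal (Real.exp (-y.toReal))) x :=
      ENNReal.continuous_ofReal.continuousAt.comp
        (Real.continuous_exp.continuousAt.comp (ENNReal.tendsto_toReal hx).neg)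
    refine h1.congr ?_
    filter_upwards [isOpen_ne.mem_nhds hx] with y hy
    exact (eneg_of_ne_top hy).symm

@[fun_prop] lemma eneg_measurable : Measurable eneg := eneg_continuous.measurable

/-- The inverse of `eneg` on `[0, 1]`. -/
noncomputable def negLog (p : ℝ≥0∞) : ℝ≥0∞ :=
  if p = 0 then ∞ else ENNReal.ofReal (-Real.log p.toReal)

lemma eneg_negLog {p : ℝ≥0∞} (hp : p ≤ 1) : eneg (negLog p) = p := by
  unfold negLog
  split_ifs with h
  · simp [h]
  have hp' : p ≠ ∞ := ne_top_of_le_ne_top ENNReal.one_ne_top hp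
  have h0 : 0 < p.toReal := ENNReal.toReal_pos h hp'
  have h1 : p.toReal ≤ 1 := by simpa using ENNReal.toReal_mono ENNReal.one_ne_top hp
  rw [eneg_ofReal (neg_nonneg.2 (Real.log_nonpos h0.le h1)), neg_neg, Real.exp_log h0,
    ENNReal.ofReal_toReal hp']

@[fun_prop] lemma negLog_measurable : Measurable negLog :=
  Measurable.ite (measurableSet_singleton 0) measurable_const (by fun_prop)

lemma laplaceTransform_eq_toReal {Ω : Type*} [MeasurableSpace Ω] (P : Measure Ω)
    {X : Ω → ℝ≥0∞} (hX : AEMeasurable X P) (z : ℝ) :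
    laplaceTransform P X z = (∫⁻ ω, eneg (ENNReal.ofReal z * X ω) ∂P).toReal := by
  have h : ∀ x, 0 ≤ expNeg x := fun x => by unfold expNeg; split_ifs <;> positivity
  have h2 : (fun x => expNeg x) = fun x => (eneg x).toReal := by
    ext x
    rw [eneg, ENNReal.toReal_ofReal (h x)]
  rw [laplaceTransform, integral_eq_lintegral_of_nonneg_ae (ae_of_all _ fun _ => h _)]
  · rfl
  · have : Measurable expNeg := by
      rw [show expNeg = fun x => (eneg x).toReal from h2]
      fun_prop
    exact (this.comp_aemeasurable (hX.const_mul _)).aestronglyMeasurable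

section Limits

variable {Ω : Type*} [MeasurableSpace Ω] {P : Measure Ω} [IsProbabilityMeasure P]

lemma tendsto_lintegral_eneg {X : ℕ → Ω → ℝ≥0∞} {Y : Ω → ℝ≥0∞}
    (hX : ∀ n, Measurable (X n))
    (hlim : ∀ ω, Filter.Tendsto (fun n => X n ω) Filter.atTop (nhds (Y ω))) :
    Filter.Tendsto (fun n => ∫⁻ ω, eneg (X n ω) ∂P) Filter.atTop
      (nhds (∫⁻ ω, eneg (Y ω) ∂P)) := by
  refine tendsto_lintegral_of_dominated_convergence (fun _ => 1) (fun n => by fun_prop)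
    (fun n => ae_of_all _ fun ω => eneg_le_one _) (by simp) (ae_of_all _ fun ω => ?_)
  exact (eneg_continuous.tendsto _).comp (hlim ω)

lemma tendsto_lintegral_eneg_tsum {f : ℕ → Ω → ℝ≥0∞} (hf : ∀ i, Measurable (f i)) :
    Filter.Tendsto (fun n => ∫⁻ ω, eneg (∑ i ∈ Finset.range n, f i ω) ∂P) Filter.atTop
      (nhds (∫⁻ ω, eneg (∑' i, f i ω) ∂P)) :=
  tendsto_lintegral_eneg (fun n => by fun_prop) fun ω => ENNReal.summable.hasSum.tendsto_sum_nat

end Limits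

/-! ### Laplace functional of the Poisson process, without and with marks -/

lemma pointCount_toENNReal {Ω : Type*} (d : ℕ → Ω → EuclideanSpace ℝ (Fin 2))
    (A : Set (EuclideanSpace ℝ (Fin 2))) (ω : Ω) :
    ((pointCount d A ω : ℕ∞) : ℝ≥0∞) = ∑' i, A.indicator (fun _ => (1 : ℝ≥0∞)) (d i ω) := by
  rw [pointCount, ← ENNReal.tsum_set_one, tsum_subtype {i : ℕ | d i ω ∈ A} fun _ => (1 : ℝ≥0∞)]
  rfl

section PointProcess

variable {Ω : Type*} [MeasurableSpace Ω] {P : Measure Ω} [IsProbabilityMeasure P]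
  {d : ℕ → Ω → EuclideanSpace ℝ (Fin 2)} {lam : ℝ}

lemma measurable_pointCount (hd : ∀ i, Measurable (d i)) {A : Set (EuclideanSpace ℝ (Fin 2))}
    (hA : MeasurableSet A) : Measurable (pointCount d A) := by
  have h1 : Measurable fun ω => ((pointCount d A ω : ℕ∞) : ℝ≥0∞) := by
    simp_rw [pointCount_toENNReal]
    exact Measurable.tsum fun i => (measurable_const.indicator hA).comp (hd i)
  refine measurable_to_countable' fun n => ?_
  have : pointCount d A ⁻¹' {n} =
      (fun ω => ((pointCount d A ω : ℕ∞) : ℝ≥0∞)) ⁻¹' {(n : ℝ≥0∞)} := by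
    ext ω
    simp
  rw [this]
  exact h1 (measurableSet_singleton _)

/-- The hypothesis describes finite counts only. Both laws are probability measures agreeing on
every finite value, so they also agree on the remaining value `⊤`. -/
lemma map_pointCount (hd : IsHomogeneousPPP P d lam) {A : Set (EuclideanSpace ℝ (Fin 2))}
    (hA : MeasurableSet A) (hA' : volume A ≠ ∞) :
    P.map (pointCount d A) =
      (poissonMeasure (lam.toNNReal * (volume A).toNNReal)).map (Nat.cast : ℕ → ℕ∞) := by
  set ν := poissonMeasure (lam.toNNReal * (volume A).toNNReal)
  have hm := measurable_pointCount hd.measurable hA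
  have hc : Measurable (Nat.cast : ℕ → ℕ∞) := measurable_of_countable _
  have : IsProbabilityMeasure (P.map (pointCount d A)) :=
    Measure.isProbabilityMeasure_map hm.aemeasurable
  have hnat : ∀ k : ℕ, P.map (pointCount d A) {(k : ℕ∞)} = ν.map (Nat.cast : ℕ → ℕ∞) {(k : ℕ∞)} := by
    intro k
    rw [Measure.map_apply hm (measurableSet_singleton _),
      Measure.map_apply hc (measurableSet_singleton _)]
    have : (Nat.cast : ℕ → ℕ∞) ⁻¹' {(k : ℕ∞)} = {k} := by ext; simp
    rw [this]
    exact hd.poisson_count A hA hA' k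
  have hU : MeasurableSet (⋃ k : ℕ, {(k : ℕ∞)}) := .of_discrete
  have hfin : P.map (pointCount d A) (⋃ k : ℕ, {(k : ℕ∞)}) =
      ν.map (Nat.cast : ℕ → ℕ∞) (⋃ k : ℕ, {(k : ℕ∞)}) := by
    have hdisj : Pairwise (Function.onFun Disjoint fun k : ℕ => ({(k : ℕ∞)} : Set ℕ∞)) := by
      intro i j hij
      simpa [Function.onFun] using hij
    rw [measure_iUnion hdisj fun _ => .of_discrete, measure_iUnion hdisj fun _ => .of_discrete]
    exact tsum_congr hnat
  have htop : ({⊤} : Set ℕ∞) = (⋃ k : ℕ, {(k : ℕ∞)})ᶜ := by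
    ext n
    induction n using ENat.recTopCoe <;> simp
  refine Measure.ext_of_singleton fun n => ?_
  induction n using ENat.recTopCoe with
  | top => rw [htop, prob_compl_eq_one_sub hU, prob_compl_eq_one_sub hU, hfin]
  | coe k => exact hnat k

/-- The generating function `E q ^ N = exp(-r (1 - q))` at `q = eneg c`, from the exponential
series. The case `c = ∞`, that is `q = 0`, is included. -/
lemma lintegral_eneg_poissonMeasure (r : ℝ≥0) (c : ℝ≥0∞) :
    ∫⁻ k : ℕ, eneg (k * c) ∂(poissonMeasure r) = eneg (r * (1 - eneg c)) := by
  rw [lintegral_countable']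
  have hq : eneg c = ENNReal.ofReal (eneg c).toReal := (ENNReal.ofReal_toReal (eneg_ne_top c)).symm
  set q := (eneg c).toReal
  have hq0 : 0 ≤ q := ENNReal.toReal_nonneg
  have hq1 : q ≤ 1 := by simpa using ENNReal.toReal_mono ENNReal.one_ne_top (eneg_le_one c)
  simp_rw [eneg_nat_mul, poissonMeasure_singleton, hq]
  have h2 : ∀ k : ℕ, ENNReal.ofReal q ^ k *
      ENNReal.ofReal (Real.exp (-r) * r ^ k / (k.factorial)) =
      ENNReal.ofReal (Real.exp (-r) * ((r * q) ^ k / (k.factorial))) := by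
    intro k
    rw [← ENNReal.ofReal_pow hq0, ← ENNReal.ofReal_mul (by positivity)]
    congr 1
    ring
  have hs : HasSum (fun k : ℕ => Real.exp (-r) * ((r * q) ^ k / (k.factorial)))
      (Real.exp (-r) * Real.exp (r * q)) := by
    have := NormedSpace.expSeries_div_hasSum_exp (r * q : ℝ)
    rw [← Real.exp_eq_exp_ℝ] at this
    exact this.mul_left _
  rw [tsum_congr h2, ← ENNReal.ofReal_tsum_of_nonneg (fun k => by positivity) hs.summable,
    hs.tsum_eq, ← ENNReal.ofReal_one, ← ENNReal.ofReal_sub _ hq0, ← ENNReal.ofReal_coe_nnreal,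
    ← ENNReal.ofReal_mul r.coe_nonneg, eneg_ofReal (mul_nonneg r.coe_nonneg (by linarith)), ← Real.exp_add]
  congr 2
  ring

lemma lintegral_eneg_pointCount (hd : IsHomogeneousPPP P d lam)
    {A : Set (EuclideanSpace ℝ (Fin 2))}
    (hA : MeasurableSet A) (hA' : volume A ≠ ∞) (c : ℝ≥0∞) :
    ∫⁻ ω, eneg ((pointCount d A ω : ℝ≥0∞) * c) ∂P =
      eneg (ENNReal.ofReal lam * volume A * (1 - eneg c)) := by
  have h1 : ∫⁻ ω, eneg ((pointCount d A ω : ℝ≥0∞) * c) ∂P =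
      ∫⁻ n : ℕ∞, eneg ((n : ℝ≥0∞) * c) ∂(P.map (pointCount d A)) :=
    (lintegral_map (f := fun n : ℕ∞ => eneg ((n : ℝ≥0∞) * c)) (measurable_of_countable _)
      (measurable_pointCount hd.measurable hA)).symm
  rw [h1, map_pointCount hd hA hA',
    lintegral_map (measurable_of_countable _) (measurable_of_countable _)]
  simp only [ENat.toENNReal_coe]
  rw [lintegral_eneg_poissonMeasure, ENNReal.coe_mul, ENNReal.coe_toNNReal hA']
  rfl

lemma lintegral_eneg_sum_pointCount (hd : IsHomogeneousPPP P d lam) {n : ℕ}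
    (A : Fin n → Set (EuclideanSpace ℝ (Fin 2))) (hA : ∀ j, MeasurableSet (A j))
    (hA' : ∀ j, volume (A j) ≠ ∞) (hdisj : Pairwise fun j k => Disjoint (A j) (A k))
    (c : Fin n → ℝ≥0∞) :
    ∫⁻ ω, eneg (∑ j, (pointCount d (A j) ω : ℝ≥0∞) * c j) ∂P =
      eneg (ENNReal.ofReal lam * ∑ j, volume (A j) * (1 - eneg (c j))) := by
  simp_rw [eneg_sum]
  have hind := (hd.indep_count n A hA hA' hdisj).comp
    (fun j (m : ℕ∞) => eneg ((m : ℝ≥0∞) * c j)) (fun j => measurable_of_countable _)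
  have := lintegral_prod_eq_prod_lintegral_of_indepFun Finset.univ _ hind fun j =>
    (measurable_of_countable _).comp (measurable_pointCount hd.measurable (hA j))
  simp only [Function.comp_def] at this
  rw [this, Finset.mul_sum, eneg_sum]
  refine Finset.prod_congr rfl fun j _ => ?_
  rw [lintegral_eneg_pointCount hd (hA j) (hA' j), mul_assoc]

-- The level sets of `s` inside `B` are disjoint and of finite area, so the sum over the points is a
-- finite combination of independent Poisson counts.
open Classical in
lemma lintegral_eneg_tsum_simpleFunc (hd : IsHomogeneousPPP P d lam)
    (s : SimpleFunc (EuclideanSpace ℝ (Fin 2)) ℝ≥0∞) {B : Set (EuclideanSpace ℝ (Fin 2))}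
    (hB : MeasurableSet B) (hB' : volume B ≠ ∞) :
    ∫⁻ ω, eneg (∑' i, B.indicator s (d i ω)) ∂P =
      eneg (ENNReal.ofReal lam * ∫⁻ x, (1 - eneg (B.indicator s x))) := by
  let e := s.range.equivFin
  let c : Fin s.range.card → ℝ≥0∞ := fun j => (e.symm j : ℝ≥0∞)
  let A : Fin s.range.card → Set (EuclideanSpace ℝ (Fin 2)) := fun j => s ⁻¹' {c j} ∩ B
  have hA : ∀ j, MeasurableSet (A j) := fun j => (s.measurableSet_preimage _).inter hB
  have hA' : ∀ j, volume (A j) ≠ ∞ := fun j => measure_ne_top_of_subset inter_subset_right hB'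
  have hdisj : Pairwise fun j k => Disjoint (A j) (A k) := by
    intro j k hjk
    refine Set.disjoint_left.2 fun x hx hx' => hjk ?_
    have : c j = c k := hx.1.symm.trans hx'.1
    exact e.symm.injective (Subtype.ext this)
  -- Used with `G = id` for the sum over points and with `G y = 1 - eneg y` for the integral; `G 0 =
  -- 0` disposes of the points outside `B`.
  have hval : ∀ (G : ℝ≥0∞ → ℝ≥0∞), G 0 = 0 → ∀ x,
      G (B.indicator s x) = ∑ j, (A j).indicator (fun _ => (1 : ℝ≥0∞)) x * G (c j) := by
    intro G hG x
    by_cases hx : x ∈ B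
    · let j₀ : Fin s.range.card := e ⟨s x, s.mem_range_self x⟩
      have hj₀ : c j₀ = s x := by simp [c, j₀]
      rw [Finset.sum_eq_single j₀]
      · have : x ∈ A j₀ := ⟨hj₀.symm, hx⟩
        simp [this, hj₀, hx]
      · intro j _ hj
        have : x ∉ A j := fun h => Set.disjoint_left.1 (hdisj hj) h ⟨hj₀.symm, hx⟩
        simp [this]
      · simp
    · have : ∀ j, x ∉ A j := fun j h => hx h.2
      simp [hx, this, hG]
  have h1 : ∀ ω, ∑' i, B.indicator s (d i ω) = ∑ j, (pointCount d (A j) ω : ℝ≥0∞) * c j := by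
    intro ω
    simp_rw [pointCount_toENNReal, ← ENNReal.tsum_mul_right]
    rw [← Summable.tsum_finsetSum fun _ _ => ENNReal.summable]
    exact tsum_congr fun i => hval id rfl _
  have h2 : ∫⁻ x, (1 - eneg (B.indicator s x)) = ∑ j, volume (A j) * (1 - eneg (c j)) := by
    simp_rw [fun x => hval (fun y => 1 - eneg y) (by simp) x]
    rw [lintegral_finsetSum _ fun j _ => (measurable_const.indicator (hA j)).mul_const _]
    refine Finset.sum_congr rfl fun j _ => ?_
    rw [lintegral_mul_const _ (measurable_const.indicator (hA j)), lintegral_indicator (hA j)]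
    simp
  simp_rw [h1, h2]
  exact lintegral_eneg_sum_pointCount hd A hA hA' hdisj c

/-- The Laplace functional of a homogeneous Poisson point process. -/
theorem lintegral_eneg_tsum (hd : IsHomogeneousPPP P d lam)
    {V : EuclideanSpace ℝ (Fin 2) → ℝ≥0∞} (hV : Measurable V) :
    ∫⁻ ω, eneg (∑' i, V (d i ω)) ∂P = eneg (ENNReal.ofReal lam * ∫⁻ x, (1 - eneg (V x))) := by
  let B : ℕ → Set (EuclideanSpace ℝ (Fin 2)) := fun n => Metric.closedBall 0 n
  have hB : ∀ n, MeasurableSet (B n) := fun n => measurableSet_closedBall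
  -- A simple approximation of `V` may be nonzero on a set of infinite area; cutting it off to balls
  -- allows the finite-area case to apply.
  let W : ℕ → EuclideanSpace ℝ (Fin 2) → ℝ≥0∞ := fun n => (B n).indicator (SimpleFunc.eapprox V n)
  have hW : ∀ n, Measurable (W n) := fun n => (SimpleFunc.measurable _).indicator (hB n)
  have hWmono : Monotone W := by
    intro m n hmn x
    refine (Set.indicator_le_indicator (SimpleFunc.monotone_eapprox V hmn x)).trans ?_
    exact Set.indicator_le_indicator_of_subset
      (Metric.closedBall_subset_closedBall (by exact_mod_cast hmn)) (fun _ => zero_le) x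
  have hWlim : ∀ x, Filter.Tendsto (fun n => W n x) Filter.atTop (nhds (V x)) := by
    intro x
    refine (SimpleFunc.tendsto_eapprox hV x).congr' ?_
    obtain ⟨N, hN⟩ := exists_nat_ge ‖x‖
    filter_upwards [Filter.eventually_ge_atTop N] with n hn
    have : x ∈ B n := by
      simp only [B, mem_closedBall_zero_iff]
      exact hN.trans (by exact_mod_cast hn)
    simp [W, this]
  have hWsup : ∀ x, ⨆ n, W n x = V x := fun x =>
    tendsto_nhds_unique (tendsto_atTop_iSup fun _ _ h => hWmono h x) (hWlim x)
  have hsumlim : ∀ ω, Filter.Tendsto (fun n => ∑' i, W n (d i ω)) Filter.atTop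
      (nhds (∑' i, V (d i ω))) := by
    intro ω
    -- Monotone convergence for the counting measure on the indices.
    have h : ∑' i, V (d i ω) = ⨆ n, ∑' i, W n (d i ω) := by
      simp_rw [← hWsup, ← lintegral_count]
      exact lintegral_iSup (fun n => measurable_of_countable _) fun m n h i => hWmono h _
    rw [h]
    exact tendsto_atTop_iSup fun m n h => ENNReal.tsum_le_tsum fun i => hWmono h _
  have hL := tendsto_lintegral_eneg (P := P)
    (fun n => Measurable.tsum fun i => (hW n).comp (hd.measurable i)) hsumlim
  have hR : Filter.Tendsto (fun n => eneg (ENNReal.ofReal lam * ∫⁻ x, (1 - eneg (W n x))))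
      Filter.atTop (nhds (eneg (ENNReal.ofReal lam * ∫⁻ x, (1 - eneg (V x))))) := by
    refine (eneg_continuous.tendsto _).comp (ENNReal.Tendsto.const_mul ?_ (Or.inr (by simp)))
    refine lintegral_tendsto_of_tendsto_of_monotone (fun n => by fun_prop) ?_ ?_
    · exact ae_of_all _ fun x m n h => tsub_le_tsub_left (eneg_antitone (hWmono h x)) 1
    · refine ae_of_all _ fun x => ?_
      exact ENNReal.Tendsto.sub tendsto_const_nhds ((eneg_continuous.tendsto _).comp (hWlim x))
        (Or.inl ENNReal.one_ne_top)
  refine tendsto_nhds_unique hL (hR.congr fun n => ?_)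
  exact (lintegral_eneg_tsum_simpleFunc hd _ (hB n)
    (measure_closedBall_lt_top).ne).symm

/-- The Laplace functional of a homogeneous Poisson point process with independent marks. -/
theorem lintegral_eneg_tsum_mark (hd : IsHomogeneousPPP P d lam) {g : ℕ → Ω → ℝ}
    {γ : Measure ℝ} (hg : ∀ i, HasLaw (g i) γ P) (hg_indep : iIndepFun g P)
    (hdg : IndepFun (fun ω i => d i ω) (fun ω i => g i ω) P)
    (hgm : ∀ i, Measurable (g i))
    {F : EuclideanSpace ℝ (Fin 2) × ℝ → ℝ≥0∞} (hF : Measurable F) :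
    ∫⁻ ω, eneg (∑' i, F (d i ω, g i ω)) ∂P =
      eneg (ENNReal.ofReal lam * ∫⁻ x, (1 - ∫⁻ y, eneg (F (x, y)) ∂γ)) := by
  have : IsProbabilityMeasure γ := (hg 0).isProbabilityMeasure_iff.1 inferInstance
  let ψ : EuclideanSpace ℝ (Fin 2) → ℝ≥0∞ := fun x => ∫⁻ y, eneg (F (x, y)) ∂γ
  have hψ : Measurable ψ := (eneg_measurable.comp hF).lintegral_prod_right'
  have hψ1 : ∀ x, ψ x ≤ 1 := fun x =>
    (lintegral_mono fun y => eneg_le_one (F (x, y))).trans (by simp)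
  have hdm : Measurable fun ω i => d i ω := measurable_pi_lambda _ hd.measurable
  have hgm' : Measurable fun ω i => g i ω := measurable_pi_lambda _ hgm
  -- Given the positions, averaging over the independent marks turns each factor into `ψ (d i)`.
  -- Writing this as `eneg (negLog (ψ (d i)))` reduces the marked sum to an unmarked one.
  have hfin : ∀ n, ∫⁻ ω, eneg (∑ i ∈ Finset.range n, F (d i ω, g i ω)) ∂P =
      ∫⁻ ω, eneg (∑ i ∈ Finset.range n, negLog (ψ (d i ω))) ∂P := by
    intro n
    have hΦ : Measurable fun p : (ℕ → EuclideanSpace ℝ (Fin 2)) × (ℕ → ℝ) =>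
        ∏ i ∈ Finset.range n, eneg (F (p.1 i, p.2 i)) := by fun_prop
    simp_rw [eneg_sum, eneg_negLog (hψ1 _)]
    calc ∫⁻ ω, ∏ i ∈ Finset.range n, eneg (F (d i ω, g i ω)) ∂P
        = ∫⁻ p, ∏ i ∈ Finset.range n, eneg (F (p.1 i, p.2 i))
            ∂(P.map fun ω => ((fun i => d i ω), (fun i => g i ω))) :=
          (lintegral_map hΦ (hdm.prodMk hgm')).symm
      _ = ∫⁻ x, ∫⁻ y, ∏ i ∈ Finset.range n, eneg (F (x i, y i))
            ∂(P.map fun ω i => g i ω) ∂(P.map fun ω i => d i ω) := by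
          rw [(indepFun_iff_map_prod_eq_prod_map_map hdm.aemeasurable hgm'.aemeasurable).1 hdg]
          have := Measure.isProbabilityMeasure_map (μ := P) hgm'.aemeasurable
          exact lintegral_prod _ hΦ.aemeasurable
      _ = ∫⁻ x, ∏ i ∈ Finset.range n, ψ (x i) ∂(P.map fun ω i => d i ω) := by
          refine lintegral_congr fun x => ?_
          rw [lintegral_map (by fun_prop) hgm']
          have hind := hg_indep.comp (fun i y => eneg (F (x i, y))) fun i => by fun_prop
          have := lintegral_prod_eq_prod_lintegral_of_indepFun (Finset.range n) _ hind
            fun i => by fun_prop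
          simp only [Function.comp_def] at this
          rw [this]
          refine Finset.prod_congr rfl fun i _ => ?_
          simp only [ψ]
          rw [← (hg i).map_eq, lintegral_map (by fun_prop) (hgm i)]
      _ = ∫⁻ ω, ∏ i ∈ Finset.range n, ψ (d i ω) ∂P := lintegral_map (by fun_prop) hdm
  have hdmi := hd.measurable
  have hL := tendsto_lintegral_eneg_tsum (P := P) (f := fun i ω => F (d i ω, g i ω))
    fun i => by fun_prop
  have hR := tendsto_lintegral_eneg_tsum (P := P) (f := fun i ω => negLog (ψ (d i ω)))
    fun i => by fun_prop
  rw [tendsto_nhds_unique (hL.congr hfin) hR,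
    lintegral_eneg_tsum hd (V := fun x => negLog (ψ x)) (by fun_prop)]
  simp_rw [eneg_negLog (hψ1 _), ψ]

end PointProcess

/-! ### Gamma gains and polar coordinates -/

/-- The Laplace transform of the Gamma distribution. -/
lemma lintegral_eneg_gammaMeasure {a r s : ℝ} (ha : 0 < a) (hr : 0 < r) (hs : 0 ≤ s) :
    ∫⁻ y, eneg (ENNReal.ofReal s * ENNReal.ofReal y) ∂(gammaMeasure a r) =
      ENNReal.ofReal ((1 + s / r) ^ (-a)) := by
  have hrs : 0 < r + s := by positivity
  have hm : ∀ q, Measurable (gammaPDF a q) := fun q => (measurable_gammaPDFReal a q).ennreal_ofReal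
  rw [gammaMeasure, lintegral_withDensity_eq_lintegral_mul _ (hm r) (by fun_prop)]
  -- Exponential tilting: the factor `exp(-s y)` turns the Gamma density of rate `r` into a multiple
  -- of the one of rate `r + s`, whose total mass is `1`.
  have key : ∀ y, (gammaPDF a r * fun y => eneg (ENNReal.ofReal s * ENNReal.ofReal y)) y =
      ENNReal.ofReal ((1 + s / r) ^ (-a)) * gammaPDF a (r + s) y := by
    intro y
    rw [Pi.mul_apply]
    rcases lt_or_ge y 0 with hy | hy
    · rw [gammaPDF_of_neg hy, gammaPDF_of_neg hy, zero_mul, mul_zero]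
    · rw [gammaPDF_of_nonneg hy, gammaPDF_of_nonneg hy, ← ENNReal.ofReal_mul hs,
        eneg_ofReal (by positivity), ← ENNReal.ofReal_mul (by positivity),
        ← ENNReal.ofReal_mul (by positivity)]
      congr 1
      have h1 : (1 + s / r) ^ (-a) * (r + s) ^ a = r ^ a := by
        rw [show 1 + s / r = (r + s) / r by field_simp, Real.rpow_neg (by positivity),
          Real.div_rpow hrs.le hr.le]
        have := Real.rpow_pos_of_pos hrs a
        field_simp
      rw [← h1, show -((r + s) * y) = -(r * y) + -(s * y) by ring, Real.exp_add]
      ring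
  rw [lintegral_congr key, lintegral_const_mul _ (hm _), lintegral_gammaPDF_eq_one ha hrs, mul_one]

/-- Integration of a radial function in the plane. -/
lemma lintegral_fun_norm_plane {f : ℝ → ℝ≥0∞} (hf : Measurable f) :
    ∫⁻ x : EuclideanSpace ℝ (Fin 2), f ‖x‖ =
      ENNReal.ofReal Real.pi * ∫⁻ r in Ioi (0 : ℝ), ENNReal.ofReal (2 * r) * f r := by
  let μ : Measure (EuclideanSpace ℝ (Fin 2)) := volume
  have hdim : Module.finrank ℝ (EuclideanSpace ℝ (Fin 2)) = 2 := by simp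
  have hball : μ (Metric.ball 0 1) = ENNReal.ofReal Real.pi := by
    simp only [μ]
    rw [InnerProductSpace.volume_ball_of_dim_even (k := 1) (by simp)]
    simp [hdim]
  calc
    ∫⁻ x, f ‖x‖ ∂μ = ∫⁻ x : ({(0)}ᶜ : Set (EuclideanSpace ℝ (Fin 2))), f (‖x.1‖)
        ∂(μ.comap (↑)) := by
      rw [lintegral_subtype_comap (measurableSet_singleton _).compl fun x ↦ f (‖x‖),
        restrict_compl_singleton]
    _ = ∫⁻ x, f x.2 ∂μ.toSphere.prod
        (.volumeIoiPow (Module.finrank ℝ (EuclideanSpace ℝ (Fin 2)) - 1)) := by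
      simpa using μ.measurePreserving_homeomorphUnitSphereProd.lintegral_comp_emb
        (Homeomorph.measurableEmbedding _) (f ∘ Subtype.val ∘ Prod.snd)
    _ = μ.toSphere univ * ∫⁻ x : Ioi (0 : ℝ), f x ∂.volumeIoiPow 1 := by
      rw [hdim, lintegral_prod _ (by fun_prop)]
      simp [mul_comm]
    _ = ENNReal.ofReal Real.pi * (2 * ∫⁻ r in Ioi (0 : ℝ), ENNReal.ofReal r * f r) := by
      rw [μ.toSphere_apply_univ, hdim, hball, Measure.volumeIoiPow,
        lintegral_withDensity_eq_lintegral_mul _ (by fun_prop) (by fun_prop),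
        ← lintegral_subtype_comap measurableSet_Ioi]
      simp
      ring
    _ = _ := by
      rw [← lintegral_const_mul _ (by fun_prop)]
      congr 1
      refine lintegral_congr fun r => ?_
      rw [ENNReal.ofReal_mul zero_le_two, mul_assoc]
      simp

/-! ### The radial integral and its antiderivatives `H₁`, `-H₂` -/

section RadialIntegral

variable {x K α r D : ℝ}

lemma one_sub_rpow_neg_nonneg (hx : 0 ≤ x) (hK : 0 ≤ K) (hr : 0 ≤ r) :
    0 ≤ 1 - (1 + x * r ^ (-α)) ^ (-K) := by
  have : 0 ≤ x * r ^ (-α) := by positivity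
  exact sub_nonneg.2 (Real.rpow_le_one_of_one_le_of_nonpos (by linarith) (by linarith))

lemma hasDerivAt_div_add_rpow (hx : 0 < x) (hr : 0 < r) :
    HasDerivAt (fun r : ℝ => x / (x + r ^ α)) (-(x * (α * r ^ (α - 1))) / (x + r ^ α) ^ 2) r := by
  have h : HasDerivAt (fun r : ℝ => x + r ^ α) (α * r ^ (α - 1)) r :=
    (Real.hasDerivAt_rpow_const (Or.inl hr.ne')).const_add x
  have := (hasDerivAt_const r x).fun_div h (by positivity)
  simpa using this

lemma div_add_rpow_mem (hx : 0 < x) (hr : 0 < r) : x / (x + r ^ α) ∈ Ioo (0 : ℝ) 1 := by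
  have := Real.rpow_pos_of_pos hr α
  exact ⟨by positivity, (div_lt_one (by positivity)).2 (by linarith)⟩

lemma betaIntegrand_continuousAt {b c t : ℝ} (ht : t ∈ Ioo (0 : ℝ) 1) :
    ContinuousAt (betaIntegrand b c) t := by
  unfold betaIntegrand
  exact (Real.continuousAt_rpow_const _ _ (Or.inl ht.1.ne')).mul
    (((continuous_const.sub continuous_id).continuousAt).rpow_const
      (Or.inl (by simpa using (sub_pos.2 ht.2).ne')))

lemma betaIntegrand_measurable (b c : ℝ) : Measurable (betaIntegrand b c) := by
  unfold betaIntegrand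
  fun_prop

/-- The change of variables `t = x / (x + r ^ α)` behind both Beta terms: the integrand times
`|dt/dr|` is the expression that also arises when the power in `r ^ 2 * (1 - (1 + x * r ^ (-α)) ^
(-K))` is differentiated. -/
lemma rpow_mul_betaIntegrand (hx : 0 < x) (hα : 0 < α) (hr : 0 < r) :
    x ^ (2 / α) * betaIntegrand (1 - 2 / α) (K + 2 / α) (x / (x + r ^ α)) *
      (x * (α * r ^ (α - 1)) / (x + r ^ α) ^ 2) =
    r ^ 2 * ((1 + x * r ^ (-α)) ^ (-K - 1) * (x * (α * r ^ (-α - 1)))) := by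
  have hR := Real.rpow_pos_of_pos hr α
  have hS : 0 < x + r ^ α := by positivity
  have h1 : 1 - x / (x + r ^ α) = r ^ α / (x + r ^ α) := by field_simp; ring
  have h2 : 1 + x * r ^ (-α) = (x + r ^ α) / r ^ α := by
    rw [Real.rpow_neg hr.le]; field_simp; ring
  rw [betaIntegrand, h1, h2]
  have e1 : r ^ 2 = r ^ (2 : ℝ) := by norm_cast
  have e2 : (x + r ^ α) ^ 2 = (x + r ^ α) ^ (2 : ℝ) := by norm_cast
  rw [e1, e2]
  rw [Real.div_rpow hx.le hS.le, Real.div_rpow hR.le hS.le, Real.div_rpow hS.le hR.le]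
  -- With `x + r ^ α` abstracted, both sides are products of powers of `x`, `r` and `S`; collecting
  -- by base leaves identities between exponents.
  generalize hSS : x + r ^ α = S at *
  simp only [← Real.rpow_mul hr.le]
  rw [show x ^ (2 / α) * (x ^ (1 - 2 / α - 1) / S ^ (1 - 2 / α - 1) *
      (r ^ (α * (K + 2 / α - 1)) / S ^ (K + 2 / α - 1))) * (x * (α * r ^ (α - 1)) / S ^ (2 : ℝ)) =
      (x * α) * ((x ^ (2 / α) * x ^ (1 - 2 / α - 1)) *
        (r ^ (α * (K + 2 / α - 1)) * r ^ (α - 1)) /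
        (S ^ (1 - 2 / α - 1) * S ^ (K + 2 / α - 1) * S ^ (2 : ℝ))) by
    field_simp,
    show r ^ (2 : ℝ) * (S ^ (-K - 1) / r ^ (α * (-K - 1)) * (x * (α * r ^ (-α - 1)))) =
      (x * α) * (S ^ (-K - 1) * (r ^ (2 : ℝ) * r ^ (-α - 1) / r ^ (α * (-K - 1)))) by
    field_simp]
  simp only [← Real.rpow_add hx, ← Real.rpow_add hr, ← Real.rpow_add hS, ← Real.rpow_sub hr]
  congr 1
  rw [show 2 / α + (1 - 2 / α - 1) = 0 by ring, Real.rpow_zero, one_mul, div_eq_mul_inv,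
    ← Real.rpow_neg hS.le, mul_comm]
  congr 2
  · ring
  · field_simp
    ring

lemma hasDerivAt_sq_mul_one_sub (hx : 0 < x) (hr : 0 < r) :
    HasDerivAt (fun r : ℝ => r ^ 2 * (1 - (1 + x * r ^ (-α)) ^ (-K)))
      (2 * r * (1 - (1 + x * r ^ (-α)) ^ (-K)) -
        K * (r ^ 2 * ((1 + x * r ^ (-α)) ^ (-K - 1) * (x * (α * r ^ (-α - 1)))))) r := by
  have h0 : HasDerivAt (fun r : ℝ => 1 + x * r ^ (-α)) (x * (-α * r ^ (-α - 1))) r :=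
    ((Real.hasDerivAt_rpow_const (Or.inl hr.ne')).const_mul x).const_add 1
  have h1 := h0.rpow_const (p := -K) (Or.inl (by positivity))
  have h2 := (hasDerivAt_pow 2 r).mul (h1.const_sub 1)
  convert! h2 using 1
  push_cast
  ring

lemma betaIntegrand_intervalIntegrable_right {b c a : ℝ} (ha : 0 < a) (hc : 1 ≤ c) :
    IntervalIntegrable (betaIntegrand b c) volume a 1 := by
  apply ContinuousOn.intervalIntegrable
  unfold betaIntegrand
  refine ContinuousOn.mul ?_ ?_
  · exact continuousOn_id.rpow_const fun t ht =>
      Or.inl (lt_of_lt_of_le (lt_min ha one_pos) ht.1).ne'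
  · exact (continuousOn_const.sub continuousOn_id).rpow_const fun t _ => Or.inr (by linarith)

lemma betaIntegrand_intervalIntegrable_left {b c a : ℝ} (hb : 0 < b) (hc : 1 ≤ c) :
    IntervalIntegrable (betaIntegrand b c) volume 0 a := by
  unfold betaIntegrand
  refine (intervalIntegral.intervalIntegrable_rpow' (by linarith)).mul_continuousOn ?_
  exact (continuousOn_const.sub continuousOn_id).rpow_const fun t _ => Or.inr (by linarith)

/-- The derivative of the Beta term cancels the second term in `hasDerivAt_sq_mul_one_sub`. -/
lemma H₁_hasDerivAt (hx : 0 < x) (hK : 1 ≤ K) (hα : 0 < α) (hr : 0 < r) :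
    HasDerivAt (fun r => H₁ x K α r) (2 * r * (1 - (1 + x * r ^ (-α)) ^ (-K))) r := by
  have hu := div_add_rpow_mem (α := α) hx hr
  have hc : 1 ≤ K + 2 / α := by
    have : 0 < 2 / α := by positivity
    linarith
  have h1 : HasDerivAt (fun a => upperBeta a (1 - 2 / α) (K + 2 / α))
      (-betaIntegrand (1 - 2 / α) (K + 2 / α) (x / (x + r ^ α))) (x / (x + r ^ α)) :=
    intervalIntegral.integral_hasDerivAt_left (betaIntegrand_intervalIntegrable_right hu.1 hc)
      (betaIntegrand_measurable _ _).stronglyMeasurable.stronglyMeasurableAtFilter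
      (betaIntegrand_continuousAt hu)
  have h2 := ((h1.comp r (hasDerivAt_div_add_rpow hx hr)).const_mul (K * x ^ (2 / α))).add
    (hasDerivAt_sq_mul_one_sub (K := K) (α := α) hx hr)
  convert! h2 using 1
  rw [← rpow_mul_betaIntegrand hx hα hr]
  ring

/-- The same cancellation with `K = 1` and opposite sign. Here `α > 2` makes `t ^ (-2 / α)`
integrable at `0`. -/
lemma H₂_hasDerivAt (hx : 0 < x) (hα : 2 < α) (hr : 0 < r) :
    HasDerivAt (fun r => H₂ x α r) (-(2 * r * (1 - (1 + x * r ^ (-α)) ^ (-1 : ℝ)))) r := by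
  have hu := div_add_rpow_mem (α := α) hx hr
  have hα0 : 0 < α := by linarith
  have hb : 0 < 1 - 2 / α := sub_pos.2 ((div_lt_one hα0).2 hα)
  have hc : 1 ≤ 1 + 2 / α := by
    have : 0 < 2 / α := by positivity
    linarith
  have h1 : HasDerivAt (fun a => lowerBeta a (1 - 2 / α) (1 + 2 / α))
      (betaIntegrand (1 - 2 / α) (1 + 2 / α) (x / (x + r ^ α))) (x / (x + r ^ α)) :=
    intervalIntegral.integral_hasDerivAt_right (betaIntegrand_intervalIntegrable_left hb hc)
      (betaIntegrand_measurable _ _).stronglyMeasurable.stronglyMeasurableAtFilter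
      (betaIntegrand_continuousAt hu)
  have h2 := (hasDerivAt_sq_mul_one_sub (K := 1) (α := α) hx hr).neg.add
    ((h1.comp r (hasDerivAt_div_add_rpow hx hr)).const_mul (x ^ (2 / α)))
  convert! h2 using 1
  · ext r
    simp only [H₂, Real.rpow_neg_one, Pi.add_apply, Pi.neg_apply, Function.comp_apply]
    ring
  · rw [← rpow_mul_betaIntegrand hx hα0 hr]
    ring

lemma H₁_zero_right (hx : 0 < x) (hα : α ≠ 0) : H₁ x K α 0 = 0 := by
  simp [H₁, upperBeta, Real.zero_rpow hα, div_self hx.ne']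

/-- Only `r = 0` needs care, since `r ^ (-α)` is unbounded there; the second summand is squeezed
between `0` and `r ^ 2`. -/
lemma H₁_continuousOn (hx : 0 < x) (hK : 1 ≤ K) (hα : 0 < α) :
    ContinuousOn (fun r => H₁ x K α r) (Icc 0 D) := by
  intro r hr
  rcases hr.1.eq_or_lt with rfl | hr0
  swap
  · exact (H₁_hasDerivAt hx hK hα hr0).continuousAt.continuousWithinAt
  have hc : 1 ≤ K + 2 / α := by
    have : 0 < 2 / α := by positivity
    linarith
  refine ContinuousWithinAt.add (ContinuousWithinAt.mul continuousWithinAt_const ?_) ?_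
  · have h1 : ContinuousAt (fun r : ℝ => x / (x + r ^ α)) 0 :=
      continuousAt_const.div (continuousAt_const.add
        (continuousAt_id.rpow_const (Or.inr hα.le))) (by simp [Real.zero_rpow hα.ne', hx.ne'])
    -- The interval passes beyond `1` so that `1`, the limit of `x / (x + r ^ α)` at `r = 0`, is an
    -- interior point.
    have hint : IntervalIntegrable (betaIntegrand (1 - 2 / α) (K + 2 / α)) volume (1 / 2) 2 := by
      apply ContinuousOn.intervalIntegrable
      unfold betaIntegrand
      refine ContinuousOn.mul ?_ ?_
      · refine continuousOn_id.rpow_const fun t ht => Or.inl ?_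
        rw [uIcc_of_le (by norm_num)] at ht
        exact (lt_of_lt_of_le (by norm_num) ht.1).ne'
      · exact (continuousOn_const.sub continuousOn_id).rpow_const fun t _ => Or.inr (by linarith)
    have h2 : ContinuousAt (fun a => upperBeta a (1 - 2 / α) (K + 2 / α)) 1 := by
      have := intervalIntegral.continuousOn_primitive_interval' hint
        (a := 1) (by rw [uIcc_of_le (by norm_num)]; constructor <;> norm_num)
      have h3 := (this 1 (by rw [uIcc_of_le (by norm_num)]; constructor <;> norm_num)).continuousAt
        (by rw [uIcc_of_le (by norm_num)]; exact Icc_mem_nhds (by norm_num) (by norm_num))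
      refine h3.neg.congr (Filter.Eventually.of_forall fun a => ?_)
      exact (intervalIntegral.integral_symm _ _).symm
    have h4 : x / (x + (0 : ℝ) ^ α) = 1 := by simp [Real.zero_rpow hα.ne', hx.ne']
    exact (ContinuousAt.comp_of_eq h2 h1 h4).continuousWithinAt
  · have h0 : Filter.Tendsto (fun r : ℝ => r ^ 2) (nhdsWithin 0 (Icc 0 D)) (nhds 0) := by
      have : ContinuousWithinAt (fun r : ℝ => r ^ 2) (Icc 0 D) 0 := by fun_prop
      simpa [ContinuousWithinAt] using this
    unfold ContinuousWithinAt
    simp only [ne_eq, OfNat.ofNat_ne_zero, not_false_eq_true, zero_pow, zero_mul]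
    refine squeeze_zero' ?_ ?_ h0
    · filter_upwards [self_mem_nhdsWithin] with r hr
      exact mul_nonneg (sq_nonneg r) (one_sub_rpow_neg_nonneg hx.le (by linarith) hr.1)
    · filter_upwards [self_mem_nhdsWithin] with r hr
      have : 0 ≤ x * r ^ (-α) := mul_nonneg hx.le (Real.rpow_nonneg hr.1 _)
      have h5 : 0 ≤ (1 + x * r ^ (-α)) ^ (-K) := Real.rpow_nonneg (by linarith) _
      nlinarith [sq_nonneg r]

lemma lintegral_Ioc_eq_H₁ (hx : 0 ≤ x) (hK : 1 ≤ K) (hα : 0 < α) (hD : 0 < D) :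
    0 ≤ H₁ x K α D ∧
    ∫⁻ r in Ioc 0 D, ENNReal.ofReal (2 * r * (1 - (1 + x * r ^ (-α)) ^ (-K))) =
      ENNReal.ofReal (H₁ x K α D) := by
  rcases hx.eq_or_lt with rfl | hx
  · have : (0 : ℝ) ^ (2 / α) = 0 := Real.zero_rpow (by positivity)
    simp [H₁, this]
  have hnn : ∀ r ∈ Ioo 0 D, 0 ≤ 2 * r * (1 - (1 + x * r ^ (-α)) ^ (-K)) := fun r hr =>
    mul_nonneg (by linarith [hr.1]) (one_sub_rpow_neg_nonneg hx.le (by linarith) hr.1.le)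
  have hnn' : ∀ r ∈ Ioc 0 D, 0 ≤ 2 * r * (1 - (1 + x * r ^ (-α)) ^ (-K)) := fun r hr =>
    mul_nonneg (by linarith [hr.1]) (one_sub_rpow_neg_nonneg hx.le (by linarith) hr.1.le)
  have hder : ∀ r ∈ Ioo 0 D, HasDerivAt (fun r => H₁ x K α r)
      (2 * r * (1 - (1 + x * r ^ (-α)) ^ (-K))) r := fun r hr => H₁_hasDerivAt hx hK hα hr.1
  -- Integrability comes for free: the derivative is nonnegative and the antiderivative is
  -- continuous up to the endpoints.
  have hint := intervalIntegral.integrableOn_deriv_of_nonneg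
    (H₁_continuousOn (D := D) hx hK hα) hder hnn
  have hFTC := intervalIntegral.integral_eq_sub_of_hasDerivAt_of_le hD.le
    (H₁_continuousOn (D := D) hx hK hα) hder
    ((intervalIntegrable_iff_integrableOn_Ioc_of_le hD.le).2 hint)
  rw [H₁_zero_right hx hα.ne', sub_zero, intervalIntegral.integral_of_le hD.le] at hFTC
  rw [← hFTC]
  exact ⟨setIntegral_nonneg measurableSet_Ioc hnn',
    (ofReal_integral_eq_lintegral_ofReal hint
      (ae_restrict_of_forall_mem measurableSet_Ioc hnn')).symm⟩

/-- The Beta integral runs over an interval shrinking to `0`, and the other term is at most `x * r ^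
(2 - α)` in absolute value. -/
lemma H₂_tendsto_atTop (hx : 0 < x) (hα : 2 < α) :
    Filter.Tendsto (fun r => H₂ x α r) Filter.atTop (nhds 0) := by
  have hα0 : 0 < α := by linarith
  have hb : 0 < 1 - 2 / α := sub_pos.2 ((div_lt_one hα0).2 hα)
  have hc : 1 ≤ 1 + 2 / α := by
    have : 0 < 2 / α := by positivity
    linarith
  have hu : Filter.Tendsto (fun r : ℝ => x / (x + r ^ α)) Filter.atTop (nhds 0) :=
    (Filter.tendsto_atTop_add_const_left _ x (tendsto_rpow_atTop hα0)).const_div_atTop x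
  have hint : IntervalIntegrable (betaIntegrand (1 - 2 / α) (1 + 2 / α)) volume (-1) 1 :=
    (betaIntegrand_intervalIntegrable_left hb hc).symm.trans
      (betaIntegrand_intervalIntegrable_left hb hc)
  have h2 : ContinuousAt (fun a => lowerBeta a (1 - 2 / α) (1 + 2 / α)) 0 := by
    have := intervalIntegral.continuousOn_primitive_interval' hint
      (a := 0) (by rw [uIcc_of_le (by norm_num)]; constructor <;> norm_num)
    exact (this 0 (by rw [uIcc_of_le (by norm_num)]; constructor <;> norm_num)).continuousAt
      (by rw [uIcc_of_le (by norm_num)]; exact Icc_mem_nhds (by norm_num) (by norm_num))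
  have h3 : lowerBeta 0 (1 - 2 / α) (1 + 2 / α) = 0 := by simp [lowerBeta]
  have h4 := h2.tendsto.comp hu
  rw [h3] at h4
  have h5 : Filter.Tendsto (fun r : ℝ => r ^ 2 * ((1 + x * r ^ (-α))⁻¹ - 1)) Filter.atTop
      (nhds 0) := by
    have hlim : Filter.Tendsto (fun r : ℝ => x * r ^ (-(α - 2))) Filter.atTop (nhds 0) := by
      simpa using (tendsto_rpow_neg_atTop (show 0 < α - 2 by linarith)).const_mul x
    refine squeeze_zero_norm' ?_ hlim
    filter_upwards [Filter.eventually_gt_atTop 0] with r hr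
    have hp : 0 < r ^ (-α) := Real.rpow_pos_of_pos hr _
    have e : x * r ^ (-(α - 2)) = r ^ 2 * (x * r ^ (-α)) := by
      rw [show -(α - 2) = -α + (2 : ℕ) by push_cast; ring, Real.rpow_add_natCast hr.ne']
      ring
    rw [e, norm_mul, Real.norm_of_nonneg (sq_nonneg r)]
    gcongr
    have hxp : 0 < x * r ^ (-α) := by positivity
    have e2 : (1 + x * r ^ (-α))⁻¹ - 1 = -(x * r ^ (-α) / (1 + x * r ^ (-α))) := by
      field_simp
      ring
    rw [e2, norm_neg, Real.norm_of_nonneg (by positivity)]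
    exact div_le_self hxp.le (by linarith)
  simpa [H₂] using h5.add (h4.const_mul (x ^ (2 / α)))

lemma lintegral_Ioi_eq_H₂ (hx : 0 ≤ x) (hα : 2 < α) (hD : 0 < D) :
    0 ≤ H₂ x α D ∧
    ∫⁻ r in Ioi D, ENNReal.ofReal (2 * r * (1 - (1 + x * r ^ (-α)) ^ (-1 : ℝ))) =
      ENNReal.ofReal (H₂ x α D) := by
  have hα0 : 0 < α := by linarith
  rcases hx.eq_or_lt with rfl | hx
  · have : (0 : ℝ) ^ (2 / α) = 0 := Real.zero_rpow (by positivity)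
    simp [H₂, this]
  have hnn : ∀ r ∈ Ioi D, 0 ≤ 2 * r * (1 - (1 + x * r ^ (-α)) ^ (-1 : ℝ)) := fun r hr => by
    have hr' : D < r := hr
    exact mul_nonneg (by linarith) (one_sub_rpow_neg_nonneg hx.le zero_le_one (by linarith))
  have hder : ∀ r ∈ Ici D, HasDerivAt (fun r => -H₂ x α r)
      (2 * r * (1 - (1 + x * r ^ (-α)) ^ (-1 : ℝ))) r := fun r hr => by
    simpa only [neg_neg] using (H₂_hasDerivAt hx hα (hD.trans_le hr)).fun_neg
  have hlim : Filter.Tendsto (fun r => -H₂ x α r) Filter.atTop (nhds 0) := by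
    simpa using (H₂_tendsto_atTop hx hα).neg
  have hint := integrableOn_Ioi_deriv_of_nonneg' hder hnn hlim
  have hFTC := integral_Ioi_of_hasDerivAt_of_nonneg' hder hnn hlim
  rw [zero_sub, neg_neg] at hFTC
  rw [← hFTC]
  exact ⟨setIntegral_nonneg measurableSet_Ioi hnn,
    (ofReal_integral_eq_lintegral_ofReal hint
      (ae_restrict_of_forall_mem measurableSet_Ioi hnn)).symm⟩

/-! ### Divergence at `α = 2` -/

lemma lintegral_ofReal_const_mul_inv_eq_top {s : Set ℝ} {c : ℝ} (hc : 0 < c)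
    (hs : MeasurableSet s) (hs0 : ∀ t ∈ s, 0 < t)
    (h : ¬ IntegrableOn (fun t : ℝ => t⁻¹) s) :
    ∫⁻ t in s, ENNReal.ofReal (c * t⁻¹) = ∞ := by
  by_contra hne
  refine h ?_
  have hm : Measurable fun t : ℝ => c * t⁻¹ := by fun_prop
  have := (lintegral_ofReal_ne_top_iff_integrable hm.aestronglyMeasurable
    (ae_restrict_of_forall_mem hs fun t ht => by have := hs0 t ht; positivity)).1 hne
  refine (this.const_mul c⁻¹).congr (Filter.Eventually.of_forall fun t => ?_)
  simp [hc.ne']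

lemma lintegral_Ioi_eq_top (hx : 0 < x) (hD : 0 < D) :
    ∫⁻ r in Ioi D, ENNReal.ofReal (2 * r * (1 - (1 + x * r ^ (-2 : ℝ)) ^ (-1 : ℝ))) = ∞ := by
  -- The integrand is `2 * x * (r ^ 2 / (r ^ 2 + x)) * r⁻¹`, and the quotient increases with `r`, so
  -- its value at `D` bounds it from below.
  have hc : 0 < 2 * x * (D ^ 2 / (D ^ 2 + x)) := by positivity
  rw [eq_top_iff, ← lintegral_ofReal_const_mul_inv_eq_top hc measurableSet_Ioi
    (fun t ht => hD.trans ht) not_integrableOn_Ioi_inv]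
  refine setLIntegral_mono (by fun_prop) fun r hr => ENNReal.ofReal_le_ofReal ?_
  have hDr : D < r := hr
  have hr0 : 0 < r := hD.trans hDr
  have e : r ^ (-2 : ℝ) = (r ^ 2)⁻¹ := by
    rw [Real.rpow_neg hr0.le]
    norm_cast
  have e2 : 2 * r * (1 - (1 + x * r ^ (-2 : ℝ)) ^ (-1 : ℝ)) =
      2 * x * (r ^ 2 / (r ^ 2 + x)) * r⁻¹ := by
    rw [e, Real.rpow_neg_one]
    field_simp
    ring
  rw [e2]
  gcongr ?_ * _
  gcongr 2 * x * ?_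
  rw [div_le_div_iff₀ (by positivity) (by positivity)]
  have : D ^ 2 ≤ r ^ 2 := by gcongr
  nlinarith

lemma lintegral_betaIntegrand_eq_top {a : ℝ} (ha0 : 0 < a) (ha1 : a < 1) :
    ∫⁻ t in Ioo 0 a, ENNReal.ofReal (betaIntegrand 0 2 t) = ∞ := by
  have hni : ¬ IntegrableOn (fun t : ℝ => t⁻¹) (Ioo 0 a) := by
    rw [← intervalIntegrable_iff_integrableOn_Ioo_of_le ha0.le]
    simp [intervalIntegrable_inv_iff, ha0.ne, ha0.le]
  -- The integrand is `(1 - t) * t⁻¹`, and `1 - t ≥ 1 - a` on the interval.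
  rw [eq_top_iff, ← lintegral_ofReal_const_mul_inv_eq_top (sub_pos.2 ha1) measurableSet_Ioo
    (fun t ht => ht.1) hni]
  refine setLIntegral_mono (betaIntegrand_measurable _ _).ennreal_ofReal
    fun t ht => ENNReal.ofReal_le_ofReal ?_
  have := inv_pos.2 ht.1
  have h2 : betaIntegrand 0 2 t = (1 - t) * t⁻¹ := by
    rw [betaIntegrand, zero_sub, Real.rpow_neg_one, show (2 : ℝ) - 1 = 1 by norm_num,
      Real.rpow_one, mul_comm]
  rw [h2]
  gcongr
  exact ht.2.le

end RadialIntegral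

/-! ### Laplace transform of shot noise -/

section Shot

variable {Ω : Type*} [MeasurableSpace Ω] {P : Measure Ω}
  {d : ℕ → Ω → EuclideanSpace ℝ (Fin 2)} {g : ℕ → Ω → ℝ} {α : ℝ} {S : Set ℝ}

open Classical in
/-- The power received at the origin from the stations whose distance lies in `S`. -/
noncomputable def shotNoise {Ω : Type*} (d : ℕ → Ω → EuclideanSpace ℝ (Fin 2))
    (g : ℕ → Ω → ℝ) (α : ℝ) (S : Set ℝ) (ω : Ω) : ℝ≥0∞ :=
  ∑' i, if ‖d i ω‖ ∈ S then ENNReal.ofReal (g i ω) * ‖d i ω‖ₑ ^ (-α) else 0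

lemma measurable_received (α : ℝ) (hS : MeasurableSet S) [DecidablePred (· ∈ S)] :
    Measurable fun p : EuclideanSpace ℝ (Fin 2) × ℝ =>
      if ‖p.1‖ ∈ S then ENNReal.ofReal p.2 * ‖p.1‖ₑ ^ (-α) else 0 :=
  Measurable.ite (hS.preimage (by fun_prop)) (by fun_prop) measurable_const

lemma aemeasurable_shotNoise (hd : ∀ i, Measurable (d i)) (hg : ∀ i, AEMeasurable (g i) P)
    (hS : MeasurableSet S) : AEMeasurable (shotNoise d g α S) P := by
  classical
  refine AEMeasurable.tsum fun i => ?_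
  convert! (measurable_received α hS).comp_aemeasurable
    ((hd i).aemeasurable.prodMk (hg i)) using 1

-- The origin is excluded because for `α > 0` the power `‖0‖ₑ ^ (-α)` is `∞`, while the real power
-- `0 ^ (-α)` is `0`.
open Classical in
lemma one_sub_lintegral_eneg_received {a ρ z : ℝ} (ha : 0 < a) (hρ : 0 < ρ) (hz : 0 ≤ z)
    {x : EuclideanSpace ℝ (Fin 2)} (hx : x ≠ 0) :
    1 - ∫⁻ y, eneg (ENNReal.ofReal z *
        if ‖x‖ ∈ S then ENNReal.ofReal y * ‖x‖ₑ ^ (-α) else 0) ∂(gammaMeasure a ρ) =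
      S.indicator (fun r => ENNReal.ofReal (1 - (1 + z / ρ * r ^ (-α)) ^ (-a))) ‖x‖ := by
  have := isProbabilityMeasure_gammaMeasure ha hρ
  by_cases hxS : ‖x‖ ∈ S
  · have hn : 0 < ‖x‖ := norm_pos_iff.2 hx
    have hp := Real.rpow_pos_of_pos hn (-α)
    have e : ∀ y, ENNReal.ofReal z * (ENNReal.ofReal y * ‖x‖ₑ ^ (-α)) =
        ENNReal.ofReal (z * ‖x‖ ^ (-α)) * ENNReal.ofReal y := by
      intro y
      rw [ENNReal.ofReal_mul hz, ← ENNReal.ofReal_rpow_of_pos hn, ofReal_norm]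
      ring
    simp only [hxS, if_true, indicator_of_mem, e]
    have h0 : 0 ≤ z * ‖x‖ ^ (-α) / ρ := by positivity
    rw [lintegral_eneg_gammaMeasure ha hρ (by positivity), ← ENNReal.ofReal_one,
      ← ENNReal.ofReal_sub _ (Real.rpow_nonneg (by linarith) _)]
    congr 4
    ring
  · simp [hxS]

/-- The Laplace transform of shot noise with Gamma distributed gains, as a radial integral. -/
theorem lintegral_eneg_shotNoise [IsProbabilityMeasure P] {lam : ℝ}
    (hd : IsHomogeneousPPP P d lam)
    {a ρ z : ℝ} (ha : 0 < a) (hρ : 0 < ρ) (hz : 0 ≤ z)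
    (hg : ∀ i, HasLaw (g i) (gammaMeasure a ρ) P) (hg_indep : iIndepFun g P)
    (hdg : IndepFun (fun ω i => d i ω) (fun ω i => g i ω) P)
    (hS : MeasurableSet S) (hS0 : S ⊆ Ici 0) :
    ∫⁻ ω, eneg (ENNReal.ofReal z * shotNoise d g α S ω) ∂P =
      eneg (ENNReal.ofReal lam * (ENNReal.ofReal Real.pi * ∫⁻ r in S,
        ENNReal.ofReal (2 * r * (1 - (1 + z / ρ * r ^ (-α)) ^ (-a))))) := by
  classical
  -- `HasLaw` gives almost everywhere measurable gains only; the marked Laplace functional is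
  -- applied to measurable versions.
  let g' : ℕ → Ω → ℝ := fun i => (hg i).aemeasurable.mk (g i)
  have hgg : ∀ i, g i =ᵐ[P] g' i := fun i => (hg i).aemeasurable.ae_eq_mk
  have hgall : ∀ᵐ ω ∂P, ∀ i, g i ω = g' i ω := ae_all_iff.2 hgg
  have hdg' : IndepFun (fun ω i => d i ω) (fun ω i => g' i ω) P :=
    hdg.congr Filter.EventuallyEq.rfl (hgall.mono fun ω h => funext h)
  have hF := (measurable_received α hS).const_mul (ENNReal.ofReal z)
  have key := lintegral_eneg_tsum_mark hd (fun i => (hg i).congr (hgg i).symm)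
    (hg_indep.congr hgg) hdg' (fun i => (hg i).aemeasurable.measurable_mk) hF
  have hX : ∀ᵐ ω ∂P, ENNReal.ofReal z * shotNoise d g α S ω = ∑' i, ENNReal.ofReal z *
      (if ‖d i ω‖ ∈ S then ENNReal.ofReal (g' i ω) * ‖d i ω‖ₑ ^ (-α) else 0) := by
    filter_upwards [hgall] with ω hω
    simp only [shotNoise, ENNReal.tsum_mul_left, hω]
  rw [lintegral_congr_ae (hX.mono fun ω h => congrArg eneg h), key]
  have hae : ∀ᵐ x : EuclideanSpace ℝ (Fin 2), x ≠ 0 := by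
    simp [ae_iff, measure_singleton]
  have hm : Measurable fun r : ℝ => ENNReal.ofReal (1 - (1 + z / ρ * r ^ (-α)) ^ (-a)) := by
    fun_prop
  rw [lintegral_congr_ae (hae.mono fun x hx => one_sub_lintegral_eneg_received ha hρ hz hx),
    lintegral_fun_norm_plane (hm.indicator hS)]
  congr 3
  have e : ∀ r : ℝ, ENNReal.ofReal (2 * r) *
      S.indicator (fun r => ENNReal.ofReal (1 - (1 + z / ρ * r ^ (-α)) ^ (-a))) r =
      S.indicator (fun r => ENNReal.ofReal (2 * r * (1 - (1 + z / ρ * r ^ (-α)) ^ (-a)))) r := by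
    intro r
    by_cases hr : r ∈ S
    · have : 0 ≤ r := hS0 hr
      simp [hr, ENNReal.ofReal_mul (show 0 ≤ 2 * r by linarith)]
    · simp [hr]
  rw [setLIntegral_congr Ioi_ae_eq_Ici, lintegral_congr e, lintegral_indicator hS,
    Measure.restrict_restrict hS, inter_eq_left.2 hS0]

lemma laplaceTransform_shotNoise [IsProbabilityMeasure P] {lam : ℝ}
    (hd : IsHomogeneousPPP P d lam) (hlam : 0 ≤ lam)
    {a ρ z H : ℝ} (ha : 0 < a) (hρ : 0 < ρ) (hz : 0 ≤ z)
    (hg : ∀ i, HasLaw (g i) (gammaMeasure a ρ) P) (hg_indep : iIndepFun g P)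
    (hdg : IndepFun (fun ω i => d i ω) (fun ω i => g i ω) P)
    (hS : MeasurableSet S) (hS0 : S ⊆ Ici 0)
    (hH : 0 ≤ H ∧ ∫⁻ r in S, ENNReal.ofReal (2 * r * (1 - (1 + z / ρ * r ^ (-α)) ^ (-a))) =
      ENNReal.ofReal H) :
    laplaceTransform P (shotNoise d g α S) z = Real.exp (-(Real.pi * lam * H)) := by
  rw [laplaceTransform_eq_toReal P
      (aemeasurable_shotNoise hd.measurable (fun i => (hg i).aemeasurable) hS),
    lintegral_eneg_shotNoise hd ha hρ hz hg hg_indep hdg hS hS0, hH.2,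
    ← ENNReal.ofReal_mul Real.pi_nonneg, ← ENNReal.ofReal_mul hlam,
    eneg_ofReal (mul_nonneg hlam (mul_nonneg Real.pi_nonneg hH.1)),
    ENNReal.toReal_ofReal (Real.exp_nonneg _)]
  congr 1
  ring

end Shot

/-! ### The useful signal and the interference -/

lemma usefulSignal_eq_shotNoise {Ω : Type*} (d : ℕ → Ω → EuclideanSpace ℝ (Fin 2))
    (g : ℕ → Ω → ℝ) (α D : ℝ) : usefulSignal d g α D = shotNoise d g α (Icc 0 D) := by
  ext ω
  simp [usefulSignal, shotNoise]

lemma interference_eq_shotNoise {Ω : Type*} (d : ℕ → Ω → EuclideanSpace ℝ (Fin 2))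
    (g : ℕ → Ω → ℝ) (α D : ℝ) : interference d g α D = shotNoise d g α (Ioi D) := by
  ext ω
  simp [interference, shotNoise]

/-- Laplace transforms of the useful signal and of the interference. `gammaMeasure` takes the shape
and the rate, so scale `pc` is rate `1 / pc`. For `α = 2` the Beta integral in `H₂` is `+∞`, and the
formula for the interference reads `E[e ^ (-z I)] = e ^ (-∞) = 0`. -/
theorem lemma2 {Ω : Type*} [MeasurableSpace Ω] (P : Measure Ω) [IsProbabilityMeasure P]
    (lam pc α D : ℝ) (Mt : ℕ)
    (hlam : 0 < lam) (hpc : 0 < pc) (hα : 2 ≤ α) (hD : 0 < D) (hMt : 2 ≤ Mt)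
    (d : ℕ → Ω → EuclideanSpace ℝ (Fin 2)) (hd : IsHomogeneousPPP P d lam)
    (g h : ℕ → Ω → ℝ)
    (hg_law : ∀ i, HasLaw (g i) (gammaMeasure ((Mt : ℝ) - 1) (1 / pc)) P)
    (hg_indep : iIndepFun g P)
    (hgd : IndepFun (fun ω i => d i ω) (fun ω i => g i ω) P)
    (hh_law : ∀ i, HasLaw (h i) (gammaMeasure 1 1) P)
    (hh_indep : iIndepFun h P)
    (hhd : IndepFun (fun ω i => d i ω) (fun ω i => h i ω) P) :
    (∀ z : ℝ, 0 ≤ z →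
      laplaceTransform P (usefulSignal d g α D) z =
        Real.exp (-(Real.pi * lam * H₁ (z * pc) ((Mt : ℝ) - 1) α D))) ∧
    (2 < α → ∀ z : ℝ, 0 ≤ z →
      laplaceTransform P (interference d h α D) z =
        Real.exp (-(Real.pi * lam * H₂ z α D))) ∧
    (α = 2 → (∀ᵐ ω ∂P, interference d h α D ω = ∞) ∧
      ∀ z : ℝ, 0 < z →
        laplaceTransform P (interference d h α D) z = 0 ∧
        ∫⁻ t in Ioo 0 (z / (z + D ^ α)),
          ENNReal.ofReal (betaIntegrand (1 - 2 / α) (1 + 2 / α) t) = ∞) := by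
  have hD0 : Ioi D ⊆ Ici 0 := fun r hr => hD.le.trans (le_of_lt hr)
  have hK : (1 : ℝ) ≤ (Mt : ℝ) - 1 := by
    have : (2 : ℝ) ≤ Mt := by exact_mod_cast hMt
    linarith
  refine ⟨fun z hz => ?_, fun hα2 z hz => ?_, ?_⟩
  · rw [usefulSignal_eq_shotNoise]
    refine laplaceTransform_shotNoise hd hlam.le (by linarith) (by positivity) hz hg_law hg_indep
      hgd measurableSet_Icc Icc_subset_Ici_self ?_
    rw [div_div_eq_mul_div, div_one, setLIntegral_congr Ioc_ae_eq_Icc.symm]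
    exact lintegral_Ioc_eq_H₁ (by positivity) hK (by linarith) hD
  · rw [interference_eq_shotNoise]
    refine laplaceTransform_shotNoise hd hlam.le one_pos one_pos hz hh_law hh_indep
      hhd measurableSet_Ioi hD0 ?_
    rw [div_one]
    exact lintegral_Ioi_eq_H₂ hz hα2 hD
  · rintro rfl
    have hzero : ∀ z : ℝ, 0 < z →
        ∫⁻ ω, eneg (ENNReal.ofReal z * interference d h 2 D ω) ∂P = 0 := by
      intro z hz
      rw [interference_eq_shotNoise, lintegral_eneg_shotNoise hd one_pos one_pos hz.le hh_law
        hh_indep hhd measurableSet_Ioi hD0, div_one, lintegral_Ioi_eq_top hz hD,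
        ENNReal.mul_top (by simp [Real.pi_pos]), ENNReal.mul_top (by simp [hlam]), eneg_top]
    have hm : AEMeasurable (interference d h 2 D) P := by
      rw [interference_eq_shotNoise]
      exact aemeasurable_shotNoise hd.measurable (fun i => (hh_law i).aemeasurable)
        measurableSet_Ioi
    refine ⟨?_, fun z hz => ⟨?_, ?_⟩⟩
    · have h1 := hzero 1 one_pos
      have hm1 : AEMeasurable (fun ω => eneg (ENNReal.ofReal 1 * interference d h 2 D ω)) P :=
        eneg_measurable.comp_aemeasurable (hm.const_mul _)
      -- A nonnegative function with zero integral vanishes almost everywhere, and `eneg` vanishes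
      -- only at `∞`.
      filter_upwards [(lintegral_eq_zero_iff' hm1).1 h1] with ω hω
      simpa [eneg_eq_zero_iff] using hω
    · rw [laplaceTransform_eq_toReal P hm, hzero z hz, ENNReal.toReal_zero]
    · have := div_add_rpow_mem (α := 2) hz hD
      norm_num only
      exact lintegral_betaIntegrand_eq_top this.1 this.2
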